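/- Let $n,m,d$ be integers with $1\le m<n$ and $d\ge n+2$. A formal vector field at $0\in\mathbb R^n$ is $X=\sum_{i=1}^n A_i\,\partial_{x_i}$ with $A_i\in\mathbb R[[x]]=\mathbb R[[x_1,\dots,x_n]]$. Write $p=(p_1,\dots,p_n)$ and $p\cdot X=\sum_i A_i\,p_i\in\mathbb R[[x]][p]$. For an $m$-tuple $\widehat X=(X^1,\dots,X^m)$ of formal vector fields let $j^d(\widehat X)$ be its $d$-jet at $0$, i.e. the family of all partial derivatives at $0$ of order at most $d$ of the components of $X^1,\dots,X^m$; it is a point of the finite-dimensional real vector space $\mathcal J^d_m(0)$ of all such families. Let $\mathcal I_{\widehat X}\subset\mathbb R[[x]][p]$ be the ideal generated by $h^k=p\cdot X^k$, $k=1,\dots,m$, and let $\mathcal L^2_{\widehat X}=\big[\,p\cdot[X^i,X^j]\,\big]_{1\le i,j\le m}$ be the formal Goh matrix. There exists an open dense set $\mathcal G\subset\mathcal J^d_m(0)$, whose complement is a semialgebraic set of codimension $n+1$, such that for every $m$-tuple $\widehat X$ of formal vector fields with $X^1(0),\dots,X^m(0)$ linearly independent and $j^d(\widehat X)\in\mathcal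 G$, the ideal $\mathcal I_{\widehat X}$ is prime, and the rank $\mathcal R(\widehat X)$ of $\mathcal L^2_{\widehat X}$ modulo $\mathcal I_{\widehat X}$, i.e. the rank over the fraction field of the domain $\mathbb R[[x]][p]/\mathcal I_{\widehat X}$, is maximal: $\mathcal R(\widehat X)=m$ if $m$ is even, and $\mathcal R(\widehat X)=m-1$ if $m$ is odd. -/

import Mathlib

open scoped Nat

noncomputable section

namespace FormalGoh

/-! ### Semialgebraic sets and their dimension -/

/-- A subset of `ℝ^σ` is semialgebraic if it is a finite union of sets, each given by finitely many
polynomial equations `p = 0` and finitely many strict polynomial inequalities `q > 0`. -/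
def IsSemialgebraic {σ : Type*} (S : Set (σ → ℝ)) : Prop :=
  ∃ F : Finset (Finset (MvPolynomial σ ℝ) × Finset (MvPolynomial σ ℝ)),
    S = {x | ∃ c ∈ F, (∀ p ∈ c.1, MvPolynomial.eval x p = 0) ∧
      ∀ q ∈ c.2, 0 < MvPolynomial.eval x q}

/-- The dimension of a semialgebraic set `S ⊆ ℝ^σ`, in the standard algebraic definition
(Bochnak, Coste and Roy): the Krull dimension of the ring `ℝ[σ] / I(S)` of polynomial functions
on `S`, where `I(S)` is the ideal of the polynomials vanishing on `S`.
It is `⊥` exactly when `S` is empty. -/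
def semialgDim {σ : Type*} (S : Set (σ → ℝ)) : WithBot ℕ∞ :=
  ringKrullDim (MvPolynomial σ ℝ ⧸ MvPolynomial.vanishingIdeal ℝ S)

/-- `S ⊆ ℝ^σ` (with `σ` finite) is semialgebraic of codimension exactly `c`;
such a set is never empty. -/
def IsSemialgebraicOfCodim {σ : Type*} (S : Set (σ → ℝ)) (c : ℕ) : Prop :=
  IsSemialgebraic S ∧ semialgDim S + (c : WithBot ℕ∞) = (Nat.card σ : WithBot ℕ∞)

/-! ### Formal vector fields and their jets at the base point, taken as the origin -/

/-- A formal vector field `∑ i, A i * ∂/∂x_i` on `ℝ^n` at the origin, `A i ∈ ℝ⟦x_1, …, x_n⟧`. -/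
abbrev FormalVF (n : ℕ) : Type := Fin n → MvPowerSeries (Fin n) ℝ

/-- The Lie bracket `[X, Y]_i = ∑ j, (X_j ∂_j Y_i - Y_j ∂_j X_i)`. -/
def lieBracket {n : ℕ} (X Y : FormalVF n) : FormalVF n := fun i =>
  ∑ j, (X j * MvPowerSeries.pderiv ℝ j (Y i) - Y j * MvPowerSeries.pderiv ℝ j (X i))

/-- Multi-indices in `n` variables of order at most `d`. -/
abbrev MultiIndex (n d : ℕ) : Type := {α : Fin n →₀ ℕ // α.degree ≤ d}

instance (n d : ℕ) : Finite (MultiIndex n d) :=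
  (Finsupp.finite_of_degree_le (σ := Fin n) d).to_subtype

/-- Labels `(k, i, α)` of the coordinates `∂^α X^k_i` of a `d`-jet. -/
abbrev JetIndex (n m d : ℕ) : Type := Fin m × Fin n × MultiIndex n d

/-- The space of `d`-jets at the origin of `m`-tuples of vector fields on `ℝ^n`. It carries the
topology of a finite-dimensional real vector space. -/
abbrev JetSpace (n m d : ℕ) : Type := JetIndex n m d → ℝ

/-- The `d`-jet of a formal `m`-tuple: all partial derivatives at the origin of order at most `d`
of all components, `∂^α f (0) = α! * (coefficient of x^α in f)`. -/
def jet {n m : ℕ} (d : ℕ) (X : Fin m → FormalVF n) : JetSpace n m d := fun t =>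
  ((∏ l, (t.2.2.1 l)! : ℕ) : ℝ) * MvPowerSeries.coeff t.2.2.1 (X t.1 t.2.1)

/-- The vectors `X^1(0), …, X^m(0)` of `ℝ^n` are linearly independent. -/
def IsLinIndepAtOrigin {n m : ℕ} (X : Fin m → FormalVF n) : Prop :=
  LinearIndependent ℝ fun k : Fin m => fun i : Fin n => MvPowerSeries.constantCoeff (X k i)

/-! ### The formal Goh matrix and its rank modulo the ideal of the annihilator -/

/-- The ring `ℝ⟦x_1, …, x_n⟧[p_1, …, p_n]`. -/
abbrev PhaseRing (n : ℕ) : Type := MvPolynomial (Fin n) (MvPowerSeries (Fin n) ℝ)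

/-- The Hamiltonian `p · X = ∑ i, X_i(x) p_i` of a formal vector field. -/
def hamiltonian {n : ℕ} (X : FormalVF n) : PhaseRing n :=
  ∑ i, MvPolynomial.C (X i) * MvPolynomial.X i

/-- The ideal generated by the Hamiltonians `h^k = p · X^k`. -/
def annIdeal {n m : ℕ} (X : Fin m → FormalVF n) : Ideal (PhaseRing n) :=
  Ideal.span (Set.range fun k => hamiltonian (X k))

/-- The formal Goh matrix `[p · [X^i, X^j]]`. -/
def gohMatrix {n m : ℕ} (X : Fin m → FormalVF n) : Matrix (Fin m) (Fin m) (PhaseRing n) :=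
  Matrix.of fun i j => hamiltonian (lieBracket (X i) (X j))

/-- The rank of a matrix over a domain `A`: the rank of its image over the fraction field. -/
def rankOverDomain {A : Type*} [CommRing A] {m : ℕ} (M : Matrix (Fin m) (Fin m) A) : ℕ :=
  (M.map (algebraMap A (FractionRing A))).rank

/-- The rank of the Goh matrix modulo the ideal `(h^1, …, h^m)`. -/
def gohRank {n m : ℕ} (X : Fin m → FormalVF n) : ℕ :=
  rankOverDomain ((gohMatrix X).map (Ideal.Quotient.mk (annIdeal X)))

end FormalGoh

end

noncomputable section

namespace FormalGoh

/-! ### Dimension of real algebraic sets -/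

/-! Since the `X k` are independent at `0`, some choice `e` of `m` coordinate directions makes the
matrix `E` of their components along `e` invertible over the power series, and `X = E Z` with a
frame `Z r = ∂_{e r} + ...` whose other components are tails `Y r i`, `i ∉ range e`. The ideal is
generated by the `p · Z r`, which eliminate the variables `p_{e r}`, so it is prime
(`isPrime_annIdeal_adaptedFrame`). The Goh matrix is skew, so its rank is at most `m`, and less if
`m` is odd.

For the lower bound fix `l ∉ range e` and evaluate at the covector that annihilates `Z` and is `1`
at `l` and `0` at the other directions outside `e`. The Goh matrix becomes `E C Eᵀ` with `C r s = Z
r (Y s l) - Z s (Y r l)` (`eval_annCovector_gohMatrix`). It suffices that a principal minor of `C`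
of even size `M = 2 * (m / 2)` is nonzero.

If that minor vanishes, restrict to the `l`-th coordinate line. A singular skew matrix of even size
over the valuation ring `ℝ⟦t⟧` has a kernel vector `v` with `v j = 1` and `v k = 0`
(`exists_mulVec_eq_zero_of_skew`). The rows `a ≠ j` of `C v = 0`, to orders `0, ..., n` in `t`,
determine `(M - 1)(n + 1)` jet coordinates from the others and from `(M - 2)(n + 1)` coefficients of
`v`. Hence the bad jets have codimension at least `n + 1` (`algDimLE_jet_kernelData`), and a Zariski
closure gives the complement of `G`. -/

open MvPolynomial in
/-- Elements picked from the successive steps of a strict chain of primes are algebraically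
independent modulo the smallest prime of the chain. -/
theorem eq_zero_of_aeval_mem_of_prime_chain {K A : Type*} [Field K] [CommRing A] [Algebra K A] :
    ∀ (L : ℕ) (P : Fin (L + 1) → Ideal A) (_ : ∀ i, (P i).IsPrime) (_ : Monotone P)
      (x : Fin L → A) (_ : ∀ i, x i ∈ P i.succ) (_ : ∀ i, x i ∉ P i.castSucc)
      (Q : MvPolynomial (Fin L) K) (_ : aeval x Q ∈ P 0), Q = 0 := by
  intro L
  induction L with
  | zero =>
    intro P hP _ x _ _ Q hQ
    obtain ⟨c, rfl⟩ := C_surjective (Fin 0) Q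
    by_contra hc
    have hc' : c ≠ 0 := fun h => hc (by rw [h, map_zero])
    rw [aeval_C] at hQ
    apply (hP 0).ne_top
    rw [Ideal.eq_top_iff_one]
    have := Ideal.mul_mem_left _ (algebraMap K A c⁻¹) hQ
    rwa [← map_mul, inv_mul_cancel₀ hc', map_one] at this
  | succ L ih =>
    intro P hP hmono x hx hx' Q hQ
    by_contra hQ0
    set q := finSuccEquiv K L Q with hq
    have hq0 : q ≠ 0 := by
      rw [hq]; exact (map_ne_zero_iff _ (finSuccEquiv K L).injective).2 hQ0
    -- As `x 0 ∉ P 0`, the power of the first variable can be cancelled modulo `P 0`. As `x 0 ∈ P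
    -- 1`, only the constant term of `r` then survives modulo `P 1`, and it is a nonzero relation
    -- for the shorter chain.
    obtain ⟨e, r, hr, hqr⟩ : ∃ (e : ℕ) (r : Polynomial (MvPolynomial (Fin L) K)),
        r.coeff 0 ≠ 0 ∧ q = Polynomial.X ^ e * r := by
      obtain ⟨r, hr, hr'⟩ := Polynomial.exists_eq_pow_rootMultiplicity_mul_and_not_dvd q hq0 0
      refine ⟨q.rootMultiplicity 0, r, ?_, by simpa using hr⟩
      rw [map_zero, sub_zero, Polynomial.X_dvd_iff] at hr'
      exact hr'
    have key : ∀ p : Polynomial (MvPolynomial (Fin L) K),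
        aeval x ((finSuccEquiv K L).symm p) =
          Polynomial.eval₂ (aeval (fun i : Fin L => x i.succ) : MvPolynomial (Fin L) K →ₐ[K] A).toRingHom
            (x 0) p := by
      intro p
      induction p using Polynomial.induction_on' with
      | add a b ha hb => rw [map_add, map_add, ha, hb, Polynomial.eval₂_add]
      | monomial k a =>
        rw [← Polynomial.C_mul_X_pow_eq_monomial, map_mul, map_mul, map_pow, map_pow,
          Polynomial.eval₂_mul, Polynomial.eval₂_pow, Polynomial.eval₂_C, Polynomial.eval₂_X]
        have h1 : (finSuccEquiv K L).symm (Polynomial.X) = X 0 := by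
          rw [AlgEquiv.symm_apply_eq, finSuccEquiv_X_zero]
        have h2 : (finSuccEquiv K L).symm (Polynomial.C a) = rename Fin.succ a := by
          rw [AlgEquiv.symm_apply_eq]
          induction a using MvPolynomial.induction_on with
          | C c => simp [finSuccEquiv_apply]
          | add a b ha hb => rw [map_add, map_add, map_add, ha, hb]
          | mul_X a i ha => rw [map_mul, map_mul, map_mul, ha, rename_X, finSuccEquiv_X_succ]
        rw [h1, h2, aeval_X, aeval_rename]
        rfl
    have hQr : aeval x Q = x 0 ^ e * Polynomial.eval₂ (aeval (fun i : Fin L => x i.succ) : MvPolynomial (Fin L) K →ₐ[K] A).toRingHom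
            (x 0) r := by
      rw [← (finSuccEquiv K L).symm_apply_apply Q, ← hq, key, hqr, Polynomial.eval₂_mul,
        Polynomial.eval₂_pow, Polynomial.eval₂_X]
    rw [hQr] at hQ
    have h0 := ((hP 0).mem_or_mem hQ).resolve_left
      fun h => hx' 0 ((hP 0).mem_of_pow_mem _ h)
    have h1 := hmono (Fin.zero_le 1) h0
    refine hr (ih (fun i => P i.succ) (fun i => hP _) (fun i j h => hmono (Fin.succ_le_succ_iff.2 h))
      (fun i => x i.succ) (fun i => hx _) (fun i => ?_) (r.coeff 0) ?_)
    · have := hx' i.succ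
      rwa [← Fin.succ_castSucc] at this
    · rw [← Polynomial.divX_mul_X_add r, Polynomial.eval₂_add, Polynomial.eval₂_mul,
        Polynomial.eval₂_X, Polynomial.eval₂_C] at h1
      have h2 := Ideal.mul_mem_left (P 1) (Polynomial.eval₂ (aeval (fun i : Fin L => x i.succ) : MvPolynomial (Fin L) K →ₐ[K] A).toRingHom
            (x 0) r.divX) (hx 0)
      exact (Ideal.add_mem_iff_right _ h2).1 h1

theorem ringKrullDim_le_of_forall_dependent {K A : Type*} [Field K] [CommRing A] [Algebra K A]
    (D : ℕ) (h : ∀ f : Fin (D + 1) → A, ∃ Q : MvPolynomial (Fin (D + 1)) K,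
      Q ≠ 0 ∧ MvPolynomial.aeval f Q = 0) : ringKrullDim A ≤ D := by
  refine iSup_le fun p => ?_
  by_contra hlt
  have hp : D + 1 ≤ p.length := by
    by_contra hle
    exact hlt (by exact_mod_cast (by omega : p.length ≤ D))
  have hlen : ∀ i : Fin (D + 1 + 1), i.1 < p.length + 1 := fun i => by omega
  let P : Fin (D + 1 + 1) → PrimeSpectrum A := fun i => p ⟨i, hlen i⟩
  have hP : StrictMono P := fun i j hij => p.strictMono hij
  have hx : ∀ i : Fin (D + 1), ∃ x, x ∈ (P i.succ).asIdeal ∧ x ∉ (P i.castSucc).asIdeal :=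
    fun i => SetLike.exists_of_lt (hP i.castSucc_lt_succ)
  choose x hx hx' using hx
  obtain ⟨Q, hQ, hQ'⟩ := h x
  exact hQ (eq_zero_of_aeval_mem_of_prime_chain (D + 1) (fun i => (P i).asIdeal)
    (fun i => (P i).isPrime) hP.monotone x hx hx' Q (hQ' ▸ Ideal.zero_mem _))

/-- Any `D + 1` polynomials are algebraically dependent on `S`. -/
def AlgDimLE {σ : Type*} (S : Set (σ → ℝ)) (D : ℕ) : Prop :=
  ∀ f : Fin (D + 1) → MvPolynomial σ ℝ, ∃ Q : MvPolynomial (Fin (D + 1)) ℝ, Q ≠ 0 ∧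
    ∀ x ∈ S, MvPolynomial.eval (fun i => MvPolynomial.eval x (f i)) Q = 0

/-- The product of the two relations works, since polynomial rings over `ℝ` are domains. -/
theorem AlgDimLE.union {σ : Type*} {S T : Set (σ → ℝ)} {D : ℕ} (hS : AlgDimLE S D)
    (hT : AlgDimLE T D) : AlgDimLE (S ∪ T) D := fun f => by
  obtain ⟨Q, hQ, hQ'⟩ := hS f
  obtain ⟨R, hR, hR'⟩ := hT f
  refine ⟨Q * R, mul_ne_zero hQ hR, fun x hx => ?_⟩
  rw [map_mul, mul_eq_zero]
  exact hx.imp (hQ' x) (hR' x)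

theorem AlgDimLE.iUnion {σ ι : Type*} [Finite ι] {S : ι → Set (σ → ℝ)} {D : ℕ}
    (hS : ∀ i, AlgDimLE (S i) D) : AlgDimLE (⋃ i, S i) D := fun f => by
  have := Fintype.ofFinite ι
  choose Q hQ hQ' using fun i => hS i f
  refine ⟨∏ i, Q i, Finset.prod_ne_zero_iff.2 fun i _ => hQ i, fun x hx => ?_⟩
  obtain ⟨i, hi⟩ := Set.mem_iUnion.1 hx
  rw [map_prod]
  exact Finset.prod_eq_zero (Finset.mem_univ i) (hQ' i x hi)

theorem AlgDimLE.semialgDim_le {σ : Type*} {S : Set (σ → ℝ)} {D : ℕ} (h : AlgDimLE S D) :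
    semialgDim S ≤ D := by
  refine ringKrullDim_le_of_forall_dependent (K := ℝ) D fun f => ?_
  choose g hg using fun i => Ideal.Quotient.mk_surjective (f i)
  obtain ⟨Q, hQ, hQ'⟩ := h g
  refine ⟨Q, hQ, ?_⟩
  have h1 : MvPolynomial.aeval f Q = Ideal.Quotient.mk (MvPolynomial.vanishingIdeal ℝ S)
      (MvPolynomial.aeval g Q) := by
    have : f = fun i => Ideal.Quotient.mkₐ ℝ (MvPolynomial.vanishingIdeal ℝ S) (g i) :=
      funext fun i => (hg i).symm
    rw [this, ← MvPolynomial.comp_aeval_apply]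
    rfl
  rw [h1, Ideal.Quotient.eq_zero_iff_mem, MvPolynomial.mem_vanishingIdeal_iff]
  intro x hx
  rw [MvPolynomial.comp_aeval_apply]
  exact hQ' x hx

/-- More than `card τ` elements of an algebra generated by a family indexed by `τ` are
algebraically dependent. -/
theorem exists_dependent_of_mem_adjoin {K A τ : Type*} [Field K] [CommRing A] [Algebra K A]
    [Finite τ] {D : ℕ} (hτ : Nat.card τ ≤ D) (g : τ → A) (f : Fin (D + 1) → A)
    (hf : ∀ i, f i ∈ Algebra.adjoin K (Set.range g)) :
    ∃ Q : MvPolynomial (Fin (D + 1)) K, Q ≠ 0 ∧ MvPolynomial.aeval f Q = 0 := by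
  have : ∀ i, ∃ F : MvPolynomial τ K, MvPolynomial.aeval g F = f i := fun i => by
    have := hf i
    rwa [Algebra.adjoin_range_eq_range_aeval] at this
  choose F hF using this
  -- The transcendence degree of `MvPolynomial τ K` is `card τ`, less than `D + 1`.
  have hdep : ¬ AlgebraicIndependent K F := by
    intro hind
    have := hind.lift_cardinalMk_le_trdeg
    rw [MvPolynomial.trdeg_of_isDomain] at this
    simp only [Cardinal.mk_fin, Cardinal.lift_natCast, Cardinal.lift_lift] at this
    have := Cardinal.toNat_le_toNat this (by simp)
    simp only [Cardinal.toNat_natCast, Cardinal.toNat_lift] at this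
    change D + 1 ≤ Nat.card τ at this
    omega
  rw [algebraicIndependent_iff] at hdep
  push Not at hdep
  obtain ⟨Q, hQ, hQ0⟩ := hdep
  refine ⟨Q, hQ0, ?_⟩
  have h := congrArg (MvPolynomial.aeval g) hQ
  rw [MvPolynomial.comp_aeval_apply, map_zero] at h
  simpa only [hF] using h

/-- Parameter counting: the image of `J` has dimension at most the number of functions `g` in which
its coordinates are polynomial. The parameter set `B` itself may be infinite-dimensional. -/
theorem AlgDimLE.of_mem_adjoin {σ B τ : Type*} [Finite τ] {D : ℕ} (hτ : Nat.card τ ≤ D)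
    (J : B → σ → ℝ) (g : τ → B → ℝ)
    (h : ∀ s, (fun b => J b s) ∈ Algebra.adjoin ℝ (Set.range g)) :
    AlgDimLE (Set.range J) D := fun f => by
  obtain ⟨Q, hQ, hQ'⟩ := exists_dependent_of_mem_adjoin (K := ℝ) hτ g
    (fun i => MvPolynomial.aeval (fun s b => J b s) (f i)) fun i => by
      have : MvPolynomial.aeval (fun s b => J b s) (f i) ∈
          (MvPolynomial.aeval (R := ℝ) (fun s b => J b s)).range := ⟨f i, rfl⟩
      rw [← Algebra.adjoin_range_eq_range_aeval] at this
      exact Algebra.adjoin_le (by rintro _ ⟨s, rfl⟩; exact h s) this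
  refine ⟨Q, hQ, ?_⟩
  rintro _ ⟨b, rfl⟩
  have := congrArg (Pi.evalAlgHom ℝ (fun _ : B => ℝ) b) hQ'
  rw [MvPolynomial.comp_aeval_apply, map_zero] at this
  simp only [MvPolynomial.comp_aeval_apply] at this
  exact this

theorem isClosed_zeroLocus {σ : Type*} (I : Ideal (MvPolynomial σ ℝ)) :
    IsClosed (MvPolynomial.zeroLocus ℝ I) := by
  have : MvPolynomial.zeroLocus ℝ I = ⋂ p ∈ I, {x | MvPolynomial.eval x p = 0} := by
    ext x; simp [MvPolynomial.mem_zeroLocus_iff, MvPolynomial.aeval_eq_eval]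
  rw [this]
  exact isClosed_biInter fun p _ => isClosed_eq (MvPolynomial.continuous_eval p) continuous_const

theorem isSemialgebraic_zeroLocus {σ : Type*} [Finite σ] (I : Ideal (MvPolynomial σ ℝ)) :
    IsSemialgebraic (MvPolynomial.zeroLocus ℝ I) := by
  obtain ⟨s, hs⟩ := IsNoetherian.noetherian I
  refine ⟨{(s, ∅)}, ?_⟩
  rw [← hs, ← Ideal.span, MvPolynomial.zeroLocus_span]
  ext x
  simp [MvPolynomial.aeval_eq_eval]

theorem dense_compl_zeroLocus {σ : Type*} [Finite σ] {I : Ideal (MvPolynomial σ ℝ)} (hI : I ≠ ⊥) :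
    Dense (MvPolynomial.zeroLocus ℝ I)ᶜ := by
  have := Fintype.ofFinite σ
  obtain ⟨p, hp, hp0⟩ := Submodule.exists_mem_ne_zero_of_ne_bot hI
  rw [← interior_eq_empty_iff_dense_compl, Set.eq_empty_iff_forall_notMem]
  intro x hx
  rw [mem_interior_iff_mem_nhds, Metric.mem_nhds_iff] at hx
  obtain ⟨ε, hε, hx⟩ := hx
  apply hp0
  -- A ball is a product of intervals, and a polynomial vanishing on a product of infinite sets is
  -- zero.
  refine MvPolynomial.funext_set (fun i => Metric.ball (x i) ε) (fun i => ?_) fun y hy => ?_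
  · rw [Real.ball_eq_Ioo]; exact Set.Ioo_infinite (by linarith)
  · rw [map_zero, ← MvPolynomial.aeval_eq_eval]
    refine (MvPolynomial.mem_zeroLocus_iff.1 (hx ?_)) p hp
    rw [← ball_pi _ hε] at *
    exact hy

/-- The points whose coordinates in `U` vanish. -/
def coordSubspace {σ : Type*} (U : Set σ) : Set (σ → ℝ) := {x | ∀ u ∈ U, x u = 0}

theorem AlgDimLE.coordSubspace {σ : Type*} [Finite σ] (U : Set σ) {D : ℕ}
    (h : Nat.card ↥Uᶜ ≤ D) : AlgDimLE (coordSubspace U) D := by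
  have key := AlgDimLE.of_mem_adjoin (B := FormalGoh.coordSubspace U) h (fun b => b.1)
    (fun (s : ↥Uᶜ) b => b.1 s) fun s => by
      by_cases hs : s ∈ U
      · convert! Subalgebra.zero_mem _ using 1
        funext b
        exact b.2 s hs
      · exact Algebra.subset_adjoin ⟨⟨s, hs⟩, rfl⟩
  rwa [Subtype.range_coe] at key

/-- Setting the coordinates in `U` to zero maps the functions on `S` onto a polynomial ring in the
remaining variables. -/
theorem le_semialgDim_of_coordSubspace_subset {σ : Type*} [Finite σ] (U : Set σ)
    {S : Set (σ → ℝ)} (h : coordSubspace U ⊆ S) : (Nat.card ↥Uᶜ : WithBot ℕ∞) ≤ semialgDim S := by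
  classical
  let restr : MvPolynomial σ ℝ →ₐ[ℝ] MvPolynomial ↥Uᶜ ℝ :=
    MvPolynomial.aeval fun s => if hs : s ∈ U then 0 else MvPolynomial.X ⟨s, hs⟩
  have hker : ∀ a ∈ MvPolynomial.vanishingIdeal ℝ S, restr a = 0 := by
    intro a ha
    refine MvPolynomial.funext fun y => ?_
    rw [map_zero, ← MvPolynomial.aeval_eq_eval, MvPolynomial.comp_aeval_apply]
    rw [MvPolynomial.mem_vanishingIdeal_iff] at ha
    refine ha _ (h fun u hu => ?_)
    simp [hu]
  have hsurj : Function.Surjective restr := by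
    rw [← AlgHom.range_eq_top, ← top_le_iff, ← MvPolynomial.adjoin_range_X]
    refine Algebra.adjoin_le ?_
    rintro _ ⟨s, rfl⟩
    exact ⟨MvPolynomial.X s.1, by simp [restr, show s.1 ∉ U from s.2]⟩
  have := ringKrullDim_le_of_surjective
    (Ideal.Quotient.lift (MvPolynomial.vanishingIdeal ℝ S) restr.toRingHom hker)
    (Ideal.Quotient.lift_surjective_of_surjective _ hker hsurj)
  rwa [MvPolynomial.ringKrullDim_of_isNoetherianRing, ringKrullDim_eq_zero_of_field,
    zero_add] at this

/-- A set of dimension at most `card σ - c` is avoided by an open dense set whose complement is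
semialgebraic of codimension exactly `c`. -/
theorem exists_open_dense_disjoint {σ : Type*} [Finite σ] {S : Set (σ → ℝ)} {D c : ℕ}
    (hc : 0 < c) (hD : D + c = Nat.card σ) (hS : AlgDimLE S D) :
    ∃ G : Set (σ → ℝ), IsOpen G ∧ Dense G ∧ IsSemialgebraicOfCodim Gᶜ c ∧ Disjoint G S := by
  have := Fintype.ofFinite σ
  obtain ⟨U, -, hU⟩ := Finset.exists_subset_card_eq (s := (Finset.univ : Finset σ)) (n := c)
    (by rw [Finset.card_univ, ← Nat.card_eq_fintype_card]; omega)
  have hUc : Nat.card ↥((U : Set σ)ᶜ) = D := by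
    rw [Nat.card_coe_set_eq, Set.ncard_compl, Set.ncard_coe_finset]; omega
  set T := S ∪ coordSubspace (U : Set σ)
  have hT : AlgDimLE T D := hS.union (.coordSubspace _ hUc.le)
  set I := MvPolynomial.vanishingIdeal ℝ T with hI
  have hTB : T ⊆ MvPolynomial.zeroLocus ℝ I := MvPolynomial.zeroLocus_vanishingIdeal_le T
  have hdim : semialgDim (MvPolynomial.zeroLocus ℝ I) = D := by
    refine le_antisymm ?_ ?_
    · refine le_trans ?_ hT.semialgDim_le
      refine ringKrullDim_le_of_surjective (Ideal.Quotient.factor ?_) (Ideal.Quotient.factor_surjective ?_)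
      all_goals exact MvPolynomial.le_vanishingIdeal_zeroLocus I
    · rw [← hUc]
      exact le_semialgDim_of_coordSubspace_subset _ (Set.subset_union_right.trans hTB)
  have hIbot : I ≠ ⊥ := by
    intro h
    rw [h, MvPolynomial.zeroLocus_bot] at hdim
    have := le_semialgDim_of_coordSubspace_subset (∅ : Set σ) (S := (⊤ : Set (σ → ℝ)))
      (Set.subset_univ _)
    rw [hdim, Set.compl_empty, Nat.card_coe_set_eq, Set.ncard_univ] at this
    have : Nat.card σ ≤ D := by exact_mod_cast this
    omega
  refine ⟨(MvPolynomial.zeroLocus ℝ I)ᶜ, (isClosed_zeroLocus I).isOpen_compl,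
    dense_compl_zeroLocus hIbot, ?_, ?_⟩
  · rw [compl_compl]
    refine ⟨isSemialgebraic_zeroLocus I, ?_⟩
    rw [hdim, ← hD]
    push_cast
    rfl
  · exact (Set.disjoint_compl_left_iff_subset.2 (Set.subset_union_left.trans hTB))

/-! ### Kernels of skew-symmetric matrices over valuation rings -/

/-- A singular matrix over a valuation ring has a kernel vector with an entry equal to `1`. -/
theorem exists_mulVec_eq_zero_of_det_eq_zero {R ι : Type*} [CommRing R] [IsDomain R]
    [ValuationRing R] [Fintype ι] [DecidableEq ι] (g : Matrix ι ι R) (hg : g.det = 0) :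
    ∃ v : ι → R, g.mulVec v = 0 ∧ ∃ j, v j = 1 := by
  obtain ⟨v, hv, hgv⟩ := Matrix.exists_mulVec_eq_zero_iff.2 hg
  obtain ⟨i₀, hi₀⟩ := Function.ne_iff.1 hv
  have : Nonempty ι := ⟨i₀⟩
  -- Divisibility is total in a valuation ring, so one entry divides all the others and can be
  -- divided out.
  obtain ⟨j, hj⟩ : ∃ j, ∀ i, v j ∣ v i := by
    classical
    obtain ⟨j, hj⟩ := Finite.exists_max (fun i => Ideal.span {v i})
    exact ⟨j, fun i => Ideal.span_singleton_le_span_singleton.1 (hj i)⟩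
  choose u hu using hj
  have hj0 : v j ≠ 0 := fun h => hi₀ (by rw [hu i₀, h, zero_mul]; rfl)
  refine ⟨u, ?_, j, mul_left_cancel₀ hj0 (by rw [← hu j, mul_one])⟩
  have h1 : v = v j • u := funext hu
  rw [h1, Matrix.mulVec_smul] at hgv
  exact (smul_eq_zero.1 hgv).resolve_left hj0

theorem det_eq_zero_of_skew_of_odd {R ι : Type*} [CommRing R] [IsDomain R] [CharZero R]
    [Fintype ι] [DecidableEq ι] (g : Matrix ι ι R) (hg : g.transpose = -g)
    (hodd : Odd (Fintype.card ι)) : g.det = 0 := by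
  have h := g.det_transpose
  rw [hg, Matrix.det_neg, hodd.neg_one_pow, neg_one_mul] at h
  exact self_eq_neg.1 h.symm

/-- Take `w` in the kernel with `w k = 1` and delete row and column `k`. The rest is skew of odd
size, hence singular; extend a normalized kernel vector of it by `0` at `k`. Row `k` of `g v`
vanishes too: by skewness `w ⬝ᵥ g v = 0`, and only the entry `k` contributes. -/
theorem exists_mulVec_eq_zero_of_skew {R ι : Type*} [CommRing R] [IsDomain R] [CharZero R]
    [ValuationRing R] [Fintype ι] [DecidableEq ι] (g : Matrix ι ι R) (hg : g.transpose = -g)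
    (heven : Even (Fintype.card ι)) (hdet : g.det = 0) :
    ∃ j k, j ≠ k ∧ ∃ v : ι → R, g.mulVec v = 0 ∧ v j = 1 ∧ v k = 0 := by
  obtain ⟨w, hw, k, hk⟩ := exists_mulVec_eq_zero_of_det_eq_zero g hdet
  let g' : Matrix {i // i ≠ k} {i // i ≠ k} R := g.submatrix Subtype.val Subtype.val
  have hcard : Odd (Fintype.card {i // i ≠ k}) := by
    have h1 := Fintype.card_subtype_compl (fun i => i = k)
    have h2 : 0 < Fintype.card ι := Fintype.card_pos_iff.2 ⟨k⟩
    rw [Fintype.card_subtype_eq] at h1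
    rw [show Fintype.card {i // i ≠ k} = Fintype.card ι - 1 from h1]
    exact Nat.Even.sub_odd h2 heven odd_one
  have hg' : g'.transpose = -g' := by
    rw [Matrix.transpose_submatrix, hg]; rfl
  obtain ⟨v', hv', j, hj⟩ := exists_mulVec_eq_zero_of_det_eq_zero g'
    (det_eq_zero_of_skew_of_odd g' hg' hcard)
  let v : ι → R := fun i => if h : i ≠ k then v' ⟨i, h⟩ else 0
  have hvk : v k = 0 := by simp [v]
  have hne : ∀ i, i ≠ k → g.mulVec v i = 0 := by
    intro i hi
    have h1 := congrFun hv' ⟨i, hi⟩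
    simp only [Matrix.mulVec, dotProduct, Pi.zero_apply] at h1 ⊢
    rw [← h1, ← Fintype.sum_subtype_add_sum_subtype (fun a => a ≠ k) (fun a => g i a * v a)]
    have h2 : ∑ a : {a // ¬ a ≠ k}, g i a * v a = 0 :=
      Finset.sum_eq_zero fun a _ => by rw [not_not.1 a.2, hvk, mul_zero]
    rw [h2, add_zero]
    exact Finset.sum_congr rfl fun a _ => by simp [g', v, a.2]
  refine ⟨j, k, j.2, v, funext fun i => ?_, ?_, hvk⟩
  · by_cases hi : i = k
    · have h1 : w ⬝ᵥ g.mulVec v = 0 := by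
        rw [Matrix.dotProduct_mulVec, ← Matrix.mulVec_transpose, hg, Matrix.neg_mulVec, hw,
          neg_zero, zero_dotProduct]
      rw [dotProduct, Finset.sum_eq_single k (fun b _ hb => by rw [hne b hb, mul_zero])
        (fun h => absurd (Finset.mem_univ k) h), hk, one_mul] at h1
      rw [hi, h1]; rfl
    · exact hne i hi
  · simp [v, j.2, hj]

/-! ### Adapted frames of a formal distribution -/

variable {n m : ℕ}

/-- The frame of the distribution which is a graph over the coordinate directions `e`, with
remaining components given by `Y`. -/
def adaptedFrame (e : Fin m ↪ Fin n) (Y : Fin m → FormalVF n) (r : Fin m) : FormalVF n := fun i =>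
  open Classical in if i ∈ Set.range e then (if i = e r then 1 else 0) else Y r i

/-- The fields whose components along `e` are those of `Y`, and which span the distribution with
adapted frame given by the other components of `Y`. -/
def assemble (e : Fin m ↪ Fin n) (Y : Fin m → FormalVF n) (k : Fin m) : FormalVF n := fun i =>
  ∑ r, Y k (e r) * adaptedFrame e Y r i

theorem adaptedFrame_apply_range (e : Fin m ↪ Fin n) (Y : Fin m → FormalVF n) (r s : Fin m) :
    adaptedFrame e Y r (e s) = if s = r then 1 else 0 := by
  simp [adaptedFrame, e.injective.eq_iff]

theorem adaptedFrame_apply_of_notMem (e : Fin m ↪ Fin n) (Y : Fin m → FormalVF n) (r : Fin m)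
    {i : Fin n} (hi : i ∉ Set.range e) : adaptedFrame e Y r i = Y r i := by
  rw [adaptedFrame, if_neg hi]

theorem assemble_apply_range (e : Fin m ↪ Fin n) (Y : Fin m → FormalVF n) (k s : Fin m) :
    assemble e Y k (e s) = Y k (e s) := by
  simp [assemble, adaptedFrame_apply_range]

/-- The components along `e`. -/
def headMatrix (e : Fin m ↪ Fin n) (Y : Fin m → FormalVF n) :
    Matrix (Fin m) (Fin m) (MvPowerSeries (Fin n) ℝ) :=
  Matrix.of fun k r => Y k (e r)

theorem exists_isUnit_submatrix {K : Type*} [Field K] (A : Matrix (Fin m) (Fin n) K)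
    (hA : LinearIndependent K A.row) :
    ∃ e : Fin m ↪ Fin n, IsUnit (A.submatrix id e) := by
  have h1 := hA.rank_matrix
  rw [Fintype.card_fin, Matrix.rank_eq_finrank_span_cols] at h1
  obtain ⟨f, hf, -, hf'⟩ := Submodule.exists_fun_fin_finrank_span_eq K (Set.range A.col)
  choose e he using hf
  let c : Fin m ≃ Fin (Module.finrank K (Submodule.span K (Set.range A.col))) := finCongr h1.symm
  have hind : LinearIndependent K (fun r => A.col (e (c r))) := by
    have : (fun r => A.col (e (c r))) = f ∘ c := funext fun r => he _
    rw [this]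
    exact hf'.comp _ c.injective
  refine ⟨⟨fun r => e (c r), fun a b hab => hind.injective (by simp only [hab])⟩, ?_⟩
  rw [← Matrix.linearIndependent_cols_iff_isUnit]
  exact hind

/-- The head matrix of `X` is invertible because its constant term is; the tails of `Y` are those of
its inverse applied to `X`. Thus `Y` has as many coefficients as `X` and serves as a chart. -/
theorem exists_assemble (X : Fin m → FormalVF n) (hX : IsLinIndepAtOrigin X) :
    ∃ (e : Fin m ↪ Fin n) (Y : Fin m → FormalVF n), assemble e Y = X ∧
      IsUnit (headMatrix e Y) := by
  obtain ⟨e, he⟩ := exists_isUnit_submatrix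
    (Matrix.of fun (k : Fin m) (i : Fin n) => MvPowerSeries.constantCoeff (X k i)) hX
  have hE : IsUnit (headMatrix e X) := by
    rw [Matrix.isUnit_iff_isUnit_det] at he ⊢
    rw [MvPowerSeries.isUnit_iff_constantCoeff, RingHom.map_det]
    exact he
  obtain ⟨F, hF⟩ := hE.exists_right_inv
  classical
  let Y : Fin m → FormalVF n := fun r i =>
    if i ∈ Set.range e then X r i else ∑ k, F r k * X k i
  have hYe : ∀ k r, Y k (e r) = X k (e r) := fun k r => if_pos ⟨r, rfl⟩
  refine ⟨e, Y, ?_, ?_⟩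
  · funext k i
    by_cases hi : i ∈ Set.range e
    · obtain ⟨s, rfl⟩ := hi
      rw [assemble_apply_range, hYe]
    · have h1 : ∀ r, adaptedFrame e Y r i = ∑ k, F r k * X k i := fun r => by
        rw [adaptedFrame_apply_of_notMem e Y r hi]
        exact if_neg hi
      simp only [assemble, hYe, h1]
      have h2 := congrFun (congrArg (fun G : Matrix _ _ _ => G.mulVec (fun k => X k i)) hF) k
      rw [← Matrix.mulVec_mulVec, Matrix.one_mulVec] at h2
      exact h2
  · have : headMatrix e Y = headMatrix e X := by
      ext k r; simp [headMatrix, hYe]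
    rwa [this]

/-! ### The ideal of the annihilator is prime -/

theorem hamiltonian_add (V W : FormalVF n) :
    hamiltonian (V + W) = hamiltonian V + hamiltonian W := by
  simp [hamiltonian, add_mul, Finset.sum_add_distrib]

theorem hamiltonian_sum {ι : Type*} (s : Finset ι) (a : ι → MvPowerSeries (Fin n) ℝ)
    (Z : ι → FormalVF n) :
    hamiltonian (fun i => ∑ r ∈ s, a r * Z r i) =
      ∑ r ∈ s, MvPolynomial.C (a r) * hamiltonian (Z r) := by
  simp only [hamiltonian, map_sum, map_mul, Finset.sum_mul, Finset.mul_sum]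
  rw [Finset.sum_comm]
  simp only [mul_assoc]

theorem hamiltonian_assemble (e : Fin m ↪ Fin n) (Y : Fin m → FormalVF n) (k : Fin m) :
    hamiltonian (assemble e Y k) =
      ∑ r, MvPolynomial.C (headMatrix e Y k r) * hamiltonian (adaptedFrame e Y r) :=
  hamiltonian_sum _ _ _

theorem annIdeal_assemble (e : Fin m ↪ Fin n) (Y : Fin m → FormalVF n)
    (hY : IsUnit (headMatrix e Y)) : annIdeal (assemble e Y) = annIdeal (adaptedFrame e Y) := by
  obtain ⟨F, hF⟩ := hY.exists_left_inv
  refine le_antisymm (Ideal.span_le.2 ?_) (Ideal.span_le.2 ?_)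
  · rintro _ ⟨k, rfl⟩
    simp only [hamiltonian_assemble]
    exact Ideal.sum_mem _ fun r _ => Ideal.mul_mem_left _ _ (Ideal.subset_span ⟨r, rfl⟩)
  · rintro _ ⟨r, rfl⟩
    have : hamiltonian (adaptedFrame e Y r) =
        ∑ k, MvPolynomial.C (F r k) * hamiltonian (assemble e Y k) := by
      have h1 := congrArg (fun G : Matrix _ _ _ => ((G.map MvPolynomial.C).mulVec
        (fun k => hamiltonian (adaptedFrame e Y k)) r : PhaseRing n)) hF
      simp only [Matrix.map_mul, Matrix.map_one _ (map_zero _) (map_one _), Matrix.one_mulVec,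
        ← Matrix.mulVec_mulVec] at h1
      rw [← h1]
      simp only [hamiltonian_assemble]
      rfl
    rw [SetLike.mem_coe]
    beta_reduce
    rw [this]
    exact Ideal.sum_mem _ fun k _ => Ideal.mul_mem_left _ _ (Ideal.subset_span ⟨k, rfl⟩)

/-- The substitution `p_{e r} ↦ p_{e r} - h_r` kills every `h_r = p · Z r` and is the identity
modulo the ideal. The ideal is therefore the kernel of an endomorphism of a domain. -/
theorem isPrime_annIdeal_adaptedFrame (e : Fin m ↪ Fin n) (Y : Fin m → FormalVF n) :
    (annIdeal (adaptedFrame e Y)).IsPrime := by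
  have : IsDomain (MvPowerSeries (Fin n) ℝ) := NoZeroDivisors.to_isDomain _
  let retract : PhaseRing n →ₐ[MvPowerSeries (Fin n) ℝ] PhaseRing n :=
    MvPolynomial.aeval fun i =>
      MvPolynomial.X i - ∑ r, if i = e r then hamiltonian (adaptedFrame e Y r) else 0
  have hham : ∀ r, retract (hamiltonian (adaptedFrame e Y r)) = 0 := by
    intro r
    have h1 : retract (hamiltonian (adaptedFrame e Y r)) = ∑ i, MvPolynomial.C (adaptedFrame e Y r i) *
        (MvPolynomial.X i - ∑ s, if i = e s then hamiltonian (adaptedFrame e Y s) else 0) := by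
      conv_lhs => rw [hamiltonian, map_sum]
      refine Finset.sum_congr rfl fun i _ => ?_
      rw [map_mul, MvPolynomial.aeval_X, MvPolynomial.algHom_C]
      rfl
    simp only [h1, mul_sub, Finset.sum_sub_distrib, Finset.mul_sum]
    rw [Finset.sum_comm (s := Finset.univ) (t := Finset.univ)]
    simp only [mul_ite, mul_zero, Finset.sum_ite_eq', Finset.mem_univ, if_true,
      adaptedFrame_apply_range]
    simp [hamiltonian]
  have hmod : ∀ f, f - retract f ∈ annIdeal (adaptedFrame e Y) := by
    intro f
    rw [← Ideal.Quotient.eq_zero_iff_mem, map_sub, sub_eq_zero]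
    have : (Ideal.Quotient.mkₐ (MvPowerSeries (Fin n) ℝ) (annIdeal (adaptedFrame e Y))) =
      (Ideal.Quotient.mkₐ (MvPowerSeries (Fin n) ℝ) (annIdeal (adaptedFrame e Y))).comp retract := by
      refine MvPolynomial.algHom_ext fun i => ?_
      rw [AlgHom.comp_apply, MvPolynomial.aeval_X]
      symm
      rw [← sub_eq_zero, ← map_sub, Ideal.Quotient.mkₐ_eq_mk, Ideal.Quotient.eq_zero_iff_mem,
        sub_sub_cancel_left]
      refine Ideal.neg_mem_iff _ |>.2 (Ideal.sum_mem _ fun r _ => ?_)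
      split_ifs
      · exact Ideal.subset_span ⟨r, rfl⟩
      · exact Ideal.zero_mem _
    exact AlgHom.congr_fun this f
  have hker : annIdeal (adaptedFrame e Y) = RingHom.ker retract.toRingHom := by
    refine le_antisymm (Ideal.span_le.2 ?_) fun f hf => ?_
    · rintro _ ⟨r, rfl⟩
      exact hham r
    · have h1 := hmod f
      rwa [show retract f = 0 from hf, sub_zero] at h1
  rw [hker]
  exact RingHom.ker_isPrime _

theorem isPrime_annIdeal_assemble (e : Fin m ↪ Fin n) (Y : Fin m → FormalVF n)
    (hY : IsUnit (headMatrix e Y)) : (annIdeal (assemble e Y)).IsPrime := by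
  rw [annIdeal_assemble e Y hY]
  exact isPrime_annIdeal_adaptedFrame e Y

/-! ### The Goh matrix in an adapted frame -/

/-- The derivative of a formal power series along a formal vector field. -/
def lieDeriv (W : FormalVF n) (f : MvPowerSeries (Fin n) ℝ) : MvPowerSeries (Fin n) ℝ :=
  ∑ j, W j * MvPowerSeries.pderiv ℝ j f

theorem lieBracket_apply (V W : FormalVF n) (i : Fin n) :
    lieBracket V W i = lieDeriv V (W i) - lieDeriv W (V i) := by
  simp [lieBracket, lieDeriv]

theorem lieDeriv_sum_right {ι : Type*} (s : Finset ι) (W : FormalVF n)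
    (b f : ι → MvPowerSeries (Fin n) ℝ) :
    lieDeriv W (∑ r ∈ s, b r * f r) = ∑ r ∈ s, (b r * lieDeriv W (f r) + lieDeriv W (b r) * f r) := by
  simp only [lieDeriv, map_sum, Derivation.leibniz, smul_eq_mul, Finset.mul_sum, Finset.sum_mul,
    ← Finset.sum_add_distrib]
  rw [Finset.sum_comm]
  refine Finset.sum_congr rfl fun r _ => Finset.sum_congr rfl fun j _ => ?_
  ring

theorem lieDeriv_sum_left {ι : Type*} (s : Finset ι) (a : ι → MvPowerSeries (Fin n) ℝ)
    (Z : ι → FormalVF n) (f : MvPowerSeries (Fin n) ℝ) :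
    lieDeriv (fun j => ∑ r ∈ s, a r * Z r j) f = ∑ r ∈ s, a r * lieDeriv (Z r) f := by
  simp only [lieDeriv, Finset.mul_sum, Finset.sum_mul]
  rw [Finset.sum_comm]
  refine Finset.sum_congr rfl fun r _ => Finset.sum_congr rfl fun j _ => ?_
  ring

theorem lieDeriv_const (W : FormalVF n) (c : ℝ) : lieDeriv W (MvPowerSeries.C c) = 0 := by
  simp [lieDeriv]

theorem lieDeriv_ite_one (W : FormalVF n) (p : Prop) [Decidable p] :
    lieDeriv W (if p then 1 else 0) = 0 := by
  split_ifs
  · rw [← map_one MvPowerSeries.C, lieDeriv_const]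
  · simp [lieDeriv]

/-- The covector annihilating the adapted frame which is `1` at `l` and `0` in the other directions
outside `e`. -/
def annCovector (e : Fin m ↪ Fin n) (l : Fin n) (Y : Fin m → FormalVF n) (i : Fin n) :
    MvPowerSeries (Fin n) ℝ :=
  (if i = l then 1 else 0) - ∑ r, if i = e r then Y r l else 0

/-- The value of the covector `annCovector` on a formal vector field. -/
theorem eval_annCovector_hamiltonian (e : Fin m ↪ Fin n) (l : Fin n) (Y : Fin m → FormalVF n)
    (W : FormalVF n) : MvPolynomial.eval (annCovector e l Y) (hamiltonian W) =
      W l - ∑ r, W (e r) * Y r l := by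
  simp only [hamiltonian, map_sum, map_mul, MvPolynomial.eval_C, MvPolynomial.eval_X, annCovector,
    mul_sub, Finset.sum_sub_distrib, Finset.mul_sum]
  rw [Finset.sum_comm (s := Finset.univ) (t := Finset.univ)]
  simp

theorem eval_annCovector_adaptedFrame (e : Fin m ↪ Fin n) {l : Fin n} (hl : l ∉ Set.range e)
    (Y : Fin m → FormalVF n) (r : Fin m) :
    MvPolynomial.eval (annCovector e l Y) (hamiltonian (adaptedFrame e Y r)) = 0 := by
  rw [eval_annCovector_hamiltonian, adaptedFrame_apply_of_notMem e Y r hl]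
  simp [adaptedFrame_apply_range]

/-- The `l`-component of the curvature of the distribution, in the adapted frame. -/
def curvature (e : Fin m ↪ Fin n) (l : Fin n) (Y : Fin m → FormalVF n) :
    Matrix (Fin m) (Fin m) (MvPowerSeries (Fin n) ℝ) :=
  Matrix.of fun r s => lieDeriv (adaptedFrame e Y r) (Y s l) - lieDeriv (adaptedFrame e Y s) (Y r l)

theorem transpose_curvature (e : Fin m ↪ Fin n) (l : Fin n) (Y : Fin m → FormalVF n) :
    (curvature e l Y).transpose = -curvature e l Y := by
  ext1 r s
  simp [curvature]

/-- The components of the frame along `e` are constant, so brackets have no component there and only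
the `l`-component is seen. -/
theorem eval_annCovector_lieBracket_adaptedFrame (e : Fin m ↪ Fin n) {l : Fin n}
    (hl : l ∉ Set.range e) (Y : Fin m → FormalVF n) (r s : Fin m) :
    MvPolynomial.eval (annCovector e l Y)
      (hamiltonian (lieBracket (adaptedFrame e Y r) (adaptedFrame e Y s))) =
      curvature e l Y r s := by
  rw [eval_annCovector_hamiltonian]
  simp [lieBracket_apply, adaptedFrame_apply_of_notMem e Y _ hl, adaptedFrame_apply_range,
    lieDeriv_ite_one, curvature]

/-- The terms that differentiate the coefficients are combinations of the `Z r`, so an annihilating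
covector sees only the bilinear part. -/
theorem lieBracket_sum {ι : Type*} (s : Finset ι) (a b : ι → MvPowerSeries (Fin n) ℝ)
    (Z : ι → FormalVF n) (i : Fin n) :
    lieBracket (fun j => ∑ r ∈ s, a r * Z r j) (fun j => ∑ r ∈ s, b r * Z r j) i =
      ∑ r ∈ s, ∑ t ∈ s, a r * b t * lieBracket (Z r) (Z t) i +
        ∑ r ∈ s, (lieDeriv (fun j => ∑ r ∈ s, a r * Z r j) (b r) -
          lieDeriv (fun j => ∑ r ∈ s, b r * Z r j) (a r)) * Z r i := by
  simp only [lieBracket_apply, lieDeriv_sum_right, sub_mul, mul_sub, Finset.sum_add_distrib,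
    Finset.sum_sub_distrib]
  simp only [lieDeriv_sum_left, Finset.mul_sum]
  have h1 : ∑ r ∈ s, ∑ t ∈ s, b r * (a t * lieDeriv (Z t) (Z r i)) =
      ∑ r ∈ s, ∑ t ∈ s, a r * b t * lieDeriv (Z r) (Z t i) := by
    rw [Finset.sum_comm]
    exact Finset.sum_congr rfl fun r _ => Finset.sum_congr rfl fun t _ => by ring
  have h2 : ∑ r ∈ s, ∑ t ∈ s, a r * (b t * lieDeriv (Z t) (Z r i)) =
      ∑ r ∈ s, ∑ t ∈ s, a r * b t * lieDeriv (Z t) (Z r i) :=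
    Finset.sum_congr rfl fun r _ => Finset.sum_congr rfl fun t _ => by ring
  rw [h1, h2]
  ring

theorem eval_annCovector_gohMatrix (e : Fin m ↪ Fin n) {l : Fin n} (hl : l ∉ Set.range e)
    (Y : Fin m → FormalVF n) :
    (gohMatrix (assemble e Y)).map (MvPolynomial.eval (annCovector e l Y)) =
      headMatrix e Y * curvature e l Y * (headMatrix e Y).transpose := by
  ext1 k k'
  have key : hamiltonian (lieBracket (assemble e Y k) (assemble e Y k')) =
      ∑ r, ∑ t, MvPolynomial.C (headMatrix e Y k r * headMatrix e Y k' t) *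
        hamiltonian (lieBracket (adaptedFrame e Y r) (adaptedFrame e Y t)) +
      ∑ r, MvPolynomial.C (lieDeriv (assemble e Y k) (headMatrix e Y k' r) -
          lieDeriv (assemble e Y k') (headMatrix e Y k r)) * hamiltonian (adaptedFrame e Y r) := by
    have hb : lieBracket (assemble e Y k) (assemble e Y k') =
        (fun i => ∑ p : Fin m × Fin m, headMatrix e Y k p.1 * headMatrix e Y k' p.2 *
          lieBracket (adaptedFrame e Y p.1) (adaptedFrame e Y p.2) i) +
        fun i => ∑ r, (lieDeriv (assemble e Y k) (headMatrix e Y k' r) -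
          lieDeriv (assemble e Y k') (headMatrix e Y k r)) * adaptedFrame e Y r i := by
      funext i
      rw [Pi.add_apply, Fintype.sum_prod_type]
      exact lieBracket_sum _ _ _ _ _
    rw [hb, hamiltonian_add, hamiltonian_sum Finset.univ
      (fun p : Fin m × Fin m => headMatrix e Y k p.1 * headMatrix e Y k' p.2)
      (fun p => lieBracket (adaptedFrame e Y p.1) (adaptedFrame e Y p.2)), hamiltonian_sum,
      Fintype.sum_prod_type]
  rw [Matrix.map_apply, gohMatrix, Matrix.of_apply, key]
  simp only [map_add, map_sum, map_mul, MvPolynomial.eval_C,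
    eval_annCovector_lieBracket_adaptedFrame e hl, eval_annCovector_adaptedFrame e hl, mul_zero,
    Finset.sum_const_zero, add_zero]
  simp only [Matrix.mul_apply, Finset.sum_mul, Matrix.transpose_apply]
  rw [Finset.sum_comm]
  exact Finset.sum_congr rfl fun r _ => Finset.sum_congr rfl fun t _ => by ring

/-! ### Bounds for the rank of the Goh matrix -/

theorem le_rankOverDomain_of_det_ne_zero {A : Type*} [CommRing A] [IsDomain A] {M : ℕ}
    (N : Matrix (Fin m) (Fin m) A) (P : Matrix (Fin M) (Fin m) A) (P' : Matrix (Fin m) (Fin M) A)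
    (h : (P * N * P').det ≠ 0) : M ≤ rankOverDomain N := by
  let f := algebraMap A (FractionRing A)
  have h1 : ((P * N * P').map f).det ≠ 0 := by
    have := f.map_det (P * N * P')
    rw [RingHom.mapMatrix_apply] at this
    rw [← this]
    exact fun h0 => h ((map_eq_zero_iff f (IsFractionRing.injective A (FractionRing A))).1 h0)
  have h2 := Matrix.rank_of_det_ne_zero h1
  rw [Fintype.card_fin, Matrix.map_mul, Matrix.map_mul] at h2
  calc M = _ := h2.symm
    _ ≤ (P.map f * N.map f).rank := Matrix.rank_mul_le_left _ _
    _ ≤ (N.map f).rank := Matrix.rank_mul_le_right _ _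

theorem rankOverDomain_le {A : Type*} [CommRing A] [IsDomain A] (N : Matrix (Fin m) (Fin m) A) :
    rankOverDomain N ≤ m :=
  (N.map (algebraMap A (FractionRing A))).rank_le_card_width.trans_eq (Fintype.card_fin m)

theorem rankOverDomain_lt_of_det_eq_zero {A : Type*} [CommRing A] [IsDomain A]
    (N : Matrix (Fin m) (Fin m) A) (h : N.det = 0) : rankOverDomain N < m := by
  let f := algebraMap A (FractionRing A)
  have h1 : (N.map f).det = 0 := by
    have := f.map_det N
    rw [RingHom.mapMatrix_apply] at this
    rw [← this, h, map_zero]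
  obtain ⟨v, hv, hNv⟩ := Matrix.exists_mulVec_eq_zero_iff.2 h1
  have h2 := (N.map f).mulVecLin.finrank_range_add_finrank_ker
  have h3 : 1 ≤ Module.finrank (FractionRing A) (LinearMap.ker (N.map f).mulVecLin) := by
    rw [Submodule.one_le_finrank_iff]
    exact fun h0 => hv ((Submodule.mem_bot _).1 (h0 ▸ LinearMap.mem_ker.2 hNv))
  rw [Module.finrank_fin_fun] at h2
  change Module.finrank (FractionRing A) (LinearMap.range (N.map f).mulVecLin) < m
  omega

theorem lieBracket_swap (V W : FormalVF n) : lieBracket V W = -lieBracket W V := by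
  funext i
  simp [lieBracket_apply]

theorem hamiltonian_neg (V : FormalVF n) : hamiltonian (-V) = -hamiltonian V := by
  refine eq_neg_of_add_eq_zero_left ?_
  rw [← hamiltonian_add, neg_add_cancel]
  simp [hamiltonian]

theorem transpose_gohMatrix (X : Fin m → FormalVF n) :
    (gohMatrix X).transpose = -gohMatrix X := by
  ext1 i j
  simp only [gohMatrix, Matrix.transpose_apply, Matrix.of_apply, Matrix.neg_apply]
  rw [lieBracket_swap, hamiltonian_neg]

theorem gohRank_le (X : Fin m → FormalVF n) (hX : (annIdeal X).IsPrime) : gohRank X ≤ m :=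
  rankOverDomain_le _

theorem gohRank_lt_of_odd (X : Fin m → FormalVF n) (hX : (annIdeal X).IsPrime) (hm : Odd m) :
    gohRank X < m := by
  have : CharZero (PhaseRing n ⧸ annIdeal X) := algebraRat.charZero _
  refine rankOverDomain_lt_of_det_eq_zero _ (det_eq_zero_of_skew_of_odd _ ?_ (by simpa using hm))
  rw [← Matrix.transpose_map, transpose_gohMatrix]
  ext1 i j
  simp

/-- Specialization cannot raise the rank: `ev` factors through the quotient, and `incl` lifts `P`,
so a minor nonzero after `ev` is nonzero modulo `I`. -/
theorem le_rankOverDomain_quotient {S T : Type*} [CommRing S] [CommRing T] {M : ℕ} (I : Ideal S)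
    [I.IsPrime] (ev : S →+* T) (incl : T →+* S) (hev : ∀ a, ev (incl a) = a)
    (hker : ∀ f ∈ I, ev f = 0) (N : Matrix (Fin m) (Fin m) S) (P : Matrix (Fin M) (Fin m) T)
    (h : (P * N.map ev * P.transpose).det ≠ 0) :
    M ≤ rankOverDomain (N.map (Ideal.Quotient.mk I)) := by
  let P' : Matrix (Fin M) (Fin m) S := P.map incl
  have hP' : P'.map ev = P := by ext1 i j; exact hev _
  refine le_rankOverDomain_of_det_ne_zero _ (P'.map (Ideal.Quotient.mk I))
    (P'.transpose.map (Ideal.Quotient.mk I)) fun h0 => h ?_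
  rw [← Matrix.map_mul, ← Matrix.map_mul, ← RingHom.mapMatrix_apply, ← RingHom.map_det,
    Ideal.Quotient.eq_zero_iff_mem] at h0
  have h1 := hker _ h0
  rwa [RingHom.map_det, RingHom.mapMatrix_apply, Matrix.map_mul, Matrix.map_mul,
    Matrix.transpose_map, hP'] at h1

theorem le_gohRank_assemble {M : ℕ} (e : Fin m ↪ Fin n) {l : Fin n} (hl : l ∉ Set.range e)
    (Y : Fin m → FormalVF n) (hY : IsUnit (headMatrix e Y)) (c : Fin M → Fin m)
    (h : ((curvature e l Y).submatrix c c).det ≠ 0) : M ≤ gohRank (assemble e Y) := by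
  have hprime := isPrime_annIdeal_assemble e Y hY
  obtain ⟨F, hF⟩ := hY.exists_left_inv
  have hker : ∀ f ∈ annIdeal (assemble e Y), MvPolynomial.eval (annCovector e l Y) f = 0 := by
    intro f hf
    have hle : annIdeal (assemble e Y) ≤ RingHom.ker (MvPolynomial.eval (annCovector e l Y)) := by
      rw [annIdeal_assemble e Y hY]
      refine Ideal.span_le.2 ?_
      rintro _ ⟨r, rfl⟩
      exact eval_annCovector_adaptedFrame e hl Y r
    exact hle hf
  -- The rows `c` of the inverse of the head matrix: this undoes the congruence and leaves a
  -- principal submatrix of the curvature.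
  let P : Matrix (Fin M) (Fin m) (MvPowerSeries (Fin n) ℝ) := F.submatrix c id
  refine le_rankOverDomain_quotient _ (MvPolynomial.eval (annCovector e l Y)) MvPolynomial.C
    (fun a => MvPolynomial.eval_C a) hker _ P ?_
  rw [eval_annCovector_gohMatrix e hl]
  have h4 : P * (headMatrix e Y * curvature e l Y * (headMatrix e Y).transpose) * P.transpose =
      (curvature e l Y).submatrix c c := by
    have h5 : P * headMatrix e Y = (1 : Matrix (Fin m) (Fin m) _).submatrix c id := by
      rw [← hF]; rfl
    calc _ = (P * headMatrix e Y) * curvature e l Y * (P * headMatrix e Y).transpose := by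
          rw [Matrix.transpose_mul]; simp only [Matrix.mul_assoc]
      _ = _ := by
          rw [h5]
          ext1 i j
          simp [Matrix.mul_apply, Matrix.one_apply]
  rwa [h4]

/-! ### Restriction of formal power series to a coordinate line -/

variable {M : ℕ}

/-- Restriction of a formal power series to the `l`-th coordinate line. -/
def lineRestrict (l : Fin n) : MvPowerSeries (Fin n) ℝ →+* PowerSeries ℝ where
  toFun f := PowerSeries.mk fun s => MvPowerSeries.coeff (Finsupp.single l s) f
  map_one' := by
    ext s
    classical
    simp [MvPowerSeries.coeff_one, PowerSeries.coeff_one]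
  map_zero' := by ext s; simp
  map_add' f g := by ext s; simp
  map_mul' f g := by
    ext s
    classical
    rw [PowerSeries.coeff_mk, MvPowerSeries.coeff_mul, Finsupp.antidiagonal_single,
      Finset.sum_map, PowerSeries.coeff_mul]
    simp

theorem coeff_lineRestrict (l : Fin n) (f : MvPowerSeries (Fin n) ℝ) (s : ℕ) :
    PowerSeries.coeff s (lineRestrict l f) = MvPowerSeries.coeff (Finsupp.single l s) f :=
  PowerSeries.coeff_mk s fun s => MvPowerSeries.coeff (Finsupp.single l s) f

theorem fst_le_of_mem_antidiagonal {N : Type*} [AddCommMonoid N] [PartialOrder N]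
    [CanonicallyOrderedAdd N] [Finset.HasAntidiagonal N] {a : N} {p : N × N}
    (hp : p ∈ Finset.HasAntidiagonal.antidiagonal a) : p.1 ≤ a :=
  Finset.HasAntidiagonal.mem_antidiagonal.1 hp ▸ le_self_add

theorem snd_le_of_mem_antidiagonal {N : Type*} [AddCommMonoid N] [PartialOrder N]
    [CanonicallyOrderedAdd N] [Finset.HasAntidiagonal N] {a : N} {p : N × N}
    (hp : p ∈ Finset.HasAntidiagonal.antidiagonal a) : p.2 ≤ a :=
  Finset.HasAntidiagonal.mem_antidiagonal.1 hp ▸ le_add_self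

/-! ### Families of power series with coefficients in an algebra of functions -/

/-- The coefficients up to order `N` of a family of power series belong to the algebra `A` of
functions of the parameter. -/
def CoeffsIn {B : Type*} (A : Subalgebra ℝ (B → ℝ)) (N : ℕ) (F : B → PowerSeries ℝ) : Prop :=
  ∀ s ≤ N, (fun b => PowerSeries.coeff s (F b)) ∈ A

namespace CoeffsIn

variable {B : Type*} {A : Subalgebra ℝ (B → ℝ)} {N : ℕ} {F G : B → PowerSeries ℝ}

theorem add (hF : CoeffsIn A N F) (hG : CoeffsIn A N G) : CoeffsIn A N fun b => F b + G b :=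
  fun s hs => by simpa only [map_add] using! A.add_mem (hF s hs) (hG s hs)

theorem neg (hF : CoeffsIn A N F) : CoeffsIn A N fun b => -F b :=
  fun s hs => by simpa only [map_neg] using! A.neg_mem (hF s hs)

theorem sub (hF : CoeffsIn A N F) (hG : CoeffsIn A N G) : CoeffsIn A N fun b => F b - G b := by
  simpa only [sub_eq_add_neg] using hF.add hG.neg

theorem zero : CoeffsIn A N fun _ => 0 :=
  fun s _ => by simpa only [map_zero] using! A.zero_mem

theorem sum {ι : Type*} (t : Finset ι) {F : ι → B → PowerSeries ℝ}
    (hF : ∀ i ∈ t, CoeffsIn A N (F i)) : CoeffsIn A N fun b => ∑ i ∈ t, F i b := fun s hs => by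
  have := A.sum_mem fun i hi => hF i hi s hs
  convert! this using 1
  funext b
  simp

theorem mul (hF : CoeffsIn A N F) (hG : CoeffsIn A N G) : CoeffsIn A N fun b => F b * G b :=
  fun s hs => by
    have := A.sum_mem (t := Finset.HasAntidiagonal.antidiagonal s) fun p hp =>
      A.mul_mem (hF p.1 ((fst_le_of_mem_antidiagonal hp).trans hs))
        (hG p.2 ((snd_le_of_mem_antidiagonal hp).trans hs))
    convert! this using 1
    funext b
    simp [PowerSeries.coeff_mul]

end CoeffsIn

/-! ### Jets of distributions whose curvature is degenerate along a line -/

/-- Component data of a distribution together with a normalized kernel vector of the restriction to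
the `l`-th coordinate line of its curvature, on the indices `c`. -/
def KernelData (e : Fin m ↪ Fin n) (l : Fin n) (c : Fin M → Fin m) (j k : Fin M) :
    Set ((Fin m → FormalVF n) × (Fin M → PowerSeries ℝ)) :=
  {b | b.2 j = 1 ∧ b.2 k = 0 ∧
    ∀ a, ∑ i, lineRestrict l (curvature e l b.1 (c a) (c i)) * b.2 i = 0}

/-- The jet coordinates determined by the kernel equation. -/
def solvedIndices (e : Fin m ↪ Fin n) (l : Fin n) (c : Fin M → Fin m) (j : Fin M) (d : ℕ) :
    Set (JetIndex n m d) :=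
  {t | ∃ (a : Fin M) (s : ℕ), a ≠ j ∧ s ≤ n ∧ t.1 = c j ∧ t.2.1 = l ∧
    t.2.2.1 = Finsupp.single l s + Finsupp.single (e (c a)) 1}

theorem degree_single_add_single (l q : Fin n) (s : ℕ) :
    (Finsupp.single l s + Finsupp.single q 1).degree = s + 1 := by
  rw [map_add, Finsupp.degree_single, Finsupp.degree_single]

/-- The pairs `(a, s)` with `a ≠ j`, `s ≤ n` give distinct multi-indices, because `l` is not among
the directions `e (c a)`. Their order `s + 1` is at most `n + 1`. -/
theorem le_card_solvedIndices (e : Fin m ↪ Fin n) {l : Fin n} (hl : l ∉ Set.range e)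
    {c : Fin M → Fin m} (hc : Function.Injective c) (j : Fin M) {d : ℕ} (hd : n + 1 ≤ d) :
    (M - 1) * (n + 1) ≤ Nat.card (solvedIndices e l c j d) := by
  have hinj : ∀ (a a' : Fin M) (s s' : ℕ), Finsupp.single l s + Finsupp.single (e (c a)) 1 =
      Finsupp.single l s' + Finsupp.single (e (c a')) 1 → a = a' ∧ s = s' := by
    intro a a' s s' h
    have hne : ∀ a, e (c a) ≠ l := fun a h => hl ⟨_, h⟩
    have h1 := DFunLike.congr_fun h l
    have h2 := DFunLike.congr_fun h (e (c a))
    simp only [Finsupp.add_apply, Finsupp.single_eq_same, Finsupp.single_apply, hne, if_false,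
      add_zero, (hne a).symm, zero_add] at h1 h2
    refine ⟨?_, h1⟩
    by_contra hne'
    rw [if_neg fun h => hne' (hc (e.injective h)).symm] at h2
    exact one_ne_zero h2
  let f : {a : Fin M // a ≠ j} × Fin (n + 1) → solvedIndices e l c j d := fun p =>
    ⟨(c j, l, ⟨Finsupp.single l p.2.1 + Finsupp.single (e (c p.1)) 1, by
      rw [degree_single_add_single]; omega⟩), p.1.1, p.2.1, p.1.2, by omega, rfl, rfl, rfl⟩
  have hf : Function.Injective f := by
    rintro ⟨a, s⟩ ⟨a', s'⟩ h
    have h1 : Finsupp.single l s.1 + Finsupp.single (e (c a)) 1 =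
        Finsupp.single l s'.1 + Finsupp.single (e (c a')) 1 :=
      congrArg (fun t : solvedIndices e l c j d => t.1.2.2.1) h
    obtain ⟨h2, h3⟩ := hinj _ _ _ _ h1
    rw [Prod.mk.injEq]
    exact ⟨Subtype.ext h2, Fin.ext h3⟩
  have := Nat.card_le_card_of_injective f hf
  rwa [Nat.card_prod, Nat.card_eq_fintype_card, Nat.card_eq_fintype_card, Fintype.card_fin,
    show Fintype.card {a : Fin M // a ≠ j} = M - 1 by simp] at this

/-- This isolates `∂_{e r}`, the only derivative that can reach a solved coordinate. -/
theorem lieDeriv_adaptedFrame (e : Fin m ↪ Fin n) (Y : Fin m → FormalVF n) (r : Fin m)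
    (f : MvPowerSeries (Fin n) ℝ) :
    lieDeriv (adaptedFrame e Y r) f = MvPowerSeries.pderiv ℝ (e r) f +
      ∑ q, open Classical in if q ∈ Set.range e then 0 else Y r q * MvPowerSeries.pderiv ℝ q f := by
  classical
  have h1 : MvPowerSeries.pderiv ℝ (e r) f =
      ∑ q, if q = e r then MvPowerSeries.pderiv ℝ q f else 0 := by simp
  rw [h1, ← Finset.sum_add_distrib, lieDeriv]
  refine Finset.sum_congr rfl fun q _ => ?_
  by_cases hq : q ∈ Set.range e
  · rw [adaptedFrame, if_pos hq, if_pos hq, add_zero, ite_mul, one_mul, zero_mul]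
  · rw [adaptedFrame_apply_of_notMem e Y r hq, if_neg hq, if_neg fun h => hq ⟨r, h.symm⟩, zero_add]

theorem card_ne_and_ne {j k : Fin M} (hjk : j ≠ k) : Nat.card {i : Fin M // i ≠ j ∧ i ≠ k} = M - 2 := by
  rw [Nat.card_eq_fintype_card, Fintype.card_subtype]
  have : (Finset.univ.filter fun i : Fin M => i ≠ j ∧ i ≠ k) = ({j, k} : Finset (Fin M))ᶜ := by
    ext i; simp
  rw [this, Finset.card_compl, Finset.card_pair hjk, Fintype.card_fin]

theorem algDimLE_jet_kernelData (e : Fin m ↪ Fin n) {l : Fin n} (hl : l ∉ Set.range e)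
    {c : Fin M → Fin m} (hc : Function.Injective c) {j k : Fin M} (hjk : j ≠ k) {d D : ℕ}
    (hd : n + 1 ≤ d) (hD : D + (n + 1) = Nat.card (JetIndex n m d)) :
    AlgDimLE ((fun b => jet d (assemble e b.1)) '' KernelData e l c j k) D := by
  classical
  set U := solvedIndices e l c j d with hU
  rw [Set.image_eq_range]
  -- The parameters are the unsolved coefficients of `Y` and the coefficients of order at most `n`
  -- of `v i` for `i ≠ j, k`. Losing `v k` as well as `v j` is what gains the final `n + 1`.
  let gen : ↥Uᶜ ⊕ ({i : Fin M // i ≠ j ∧ i ≠ k} × Fin (n + 1)) → KernelData e l c j k → ℝ :=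
    Sum.elim (fun t b => MvPowerSeries.coeff t.1.2.2.1 (b.1.1 t.1.1 t.1.2.1))
      (fun p b => PowerSeries.coeff p.2.1 (b.1.2 p.1))
  have hcard : Nat.card (↥Uᶜ ⊕ ({i : Fin M // i ≠ j ∧ i ≠ k} × Fin (n + 1))) ≤ D := by
    have h1 := le_card_solvedIndices e hl hc j hd
    have h2 := Set.ncard_add_ncard_compl U
    have h3 : 2 ≤ M := by
      have := Fin.val_ne_of_ne hjk
      omega
    rw [Nat.card_sum, Nat.card_prod, card_ne_and_ne hjk, Nat.card_eq_fintype_card (α := Fin _),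
      Fintype.card_fin, Nat.card_coe_set_eq]
    rw [Nat.card_coe_set_eq] at h1
    obtain ⟨M', rfl⟩ := Nat.exists_eq_add_of_le h3
    have h4 : (2 + M' - 1) * (n + 1) = (2 + M' - 2) * (n + 1) + (n + 1) := by
      rw [show 2 + M' - 1 = M' + 1 by omega, show 2 + M' - 2 = M' by omega]; ring
    change _ ≤ U.ncard at h1
    omega
  refine AlgDimLE.of_mem_adjoin hcard _ gen ?_
  set A := Algebra.adjoin ℝ (Set.range gen) with hA
  have hconst : ∀ x : ℝ, (fun _ : KernelData e l c j k => x) ∈ A := fun x => A.algebraMap_mem x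
  have hfree : ∀ (r : Fin m) (i : Fin n) (α : Fin n →₀ ℕ) (hα : α.degree ≤ d),
      (r, i, ⟨α, hα⟩) ∉ U → (fun b : KernelData e l c j k => MvPowerSeries.coeff α (b.1.1 r i)) ∈ A :=
    fun r i α hα ht => Algebra.subset_adjoin ⟨Sum.inl ⟨(r, i, ⟨α, hα⟩), ht⟩, rfl⟩
  have hv : ∀ i, i ≠ j → CoeffsIn A n fun b : KernelData e l c j k => b.1.2 i := by
    intro i hi
    by_cases hik : i = k
    · have : (fun b : KernelData e l c j k => b.1.2 i) = fun _ => 0 := by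
        funext b; rw [hik]; exact b.2.2.1
      rw [this]
      exact CoeffsIn.zero
    · exact fun s hs => Algebra.subset_adjoin
        ⟨Sum.inr (⟨i, hi, hik⟩, ⟨s, Nat.lt_succ_of_le hs⟩), rfl⟩
  have hline : ∀ r i, CoeffsIn A n fun b : KernelData e l c j k => lineRestrict l (b.1.1 r i) := by
    intro r i s hs
    simp only [coeff_lineRestrict]
    refine hfree r i _ (by rw [Finsupp.degree_single]; omega) ?_
    rintro ⟨a, s', -, -, -, -, h⟩
    have h1 := DFunLike.congr_fun h (e (c a))
    have hne : l ≠ e (c a) := fun h => hl ⟨_, h.symm⟩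
    simp [hne] at h1
  -- The coefficients involved sit at `s` times `l` plus `q`, which is solved only if `r = c j` and
  -- `q` lies in the range of `e`.
  have hpderiv : ∀ r q, (r ≠ c j ∨ q ∉ Set.range e) → CoeffsIn A n
      fun b : KernelData e l c j k => lineRestrict l (MvPowerSeries.pderiv ℝ q (b.1.1 r l)) := by
    intro r q hrq s hs
    simp only [coeff_lineRestrict, MvPowerSeries.coeff_pderiv]
    refine A.mul_mem (hfree r l _ (by rw [degree_single_add_single]; omega) ?_) (hconst _)
    rintro ⟨a, s', -, -, hr, -, h⟩
    refine hrq.elim (fun h => h hr) fun hq => ?_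
    have h1 := DFunLike.congr_fun h (e (c a))
    have hne : l ≠ e (c a) := fun h => hl ⟨_, h.symm⟩
    have hne' : q ≠ e (c a) := fun h => hq ⟨_, h.symm⟩
    simp [hne, hne'] at h1
  have htail : ∀ r s, CoeffsIn A n fun b : KernelData e l c j k => lineRestrict l
      (∑ q, if q ∈ Set.range e then 0 else b.1.1 r q * MvPowerSeries.pderiv ℝ q (b.1.1 s l)) := by
    intro r s
    simp only [map_sum]
    refine CoeffsIn.sum _ fun q _ => ?_
    by_cases hq : q ∈ Set.range e
    · simp only [if_pos hq, map_zero]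
      exact CoeffsIn.zero
    · simp only [if_neg hq, map_mul]
      exact (hline r q).mul (hpderiv s q (Or.inr hq))
  have hlie : ∀ r s, s ≠ c j → CoeffsIn A n fun b : KernelData e l c j k =>
      lineRestrict l (lieDeriv (adaptedFrame e b.1.1 r) (b.1.1 s l)) := by
    intro r s hs
    simp only [lieDeriv_adaptedFrame, map_add]
    exact (hpderiv s _ (Or.inl hs)).add (htail r s)
  have hsolved : ∀ a, a ≠ j → CoeffsIn A n fun b : KernelData e l c j k =>
      lineRestrict l (MvPowerSeries.pderiv ℝ (e (c a)) (b.1.1 (c j) l)) := by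
    intro a ha
    -- With `a` and `i` both different from `j`, the curvature entry contains no derivative of `Y (c
    -- j) l`.
    have hsum : CoeffsIn A n fun b : KernelData e l c j k => ∑ i ∈ Finset.univ.erase j,
        lineRestrict l (curvature e l b.1.1 (c a) (c i)) * b.1.2 i := by
      refine CoeffsIn.sum _ fun i hi => ?_
      have hij := Finset.ne_of_mem_erase hi
      refine CoeffsIn.mul ?_ (hv i hij)
      simp only [curvature, Matrix.of_apply, map_sub]
      exact (hlie _ _ (hc.ne hij)).sub (hlie _ _ (hc.ne ha))
    have heq : ∀ b : KernelData e l c j k,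
        lineRestrict l (MvPowerSeries.pderiv ℝ (e (c a)) (b.1.1 (c j) l)) =
        lineRestrict l (lieDeriv (adaptedFrame e b.1.1 (c j)) (b.1.1 (c a) l)) - lineRestrict l
          (∑ q, if q ∈ Set.range e then 0
            else b.1.1 (c a) q * MvPowerSeries.pderiv ℝ q (b.1.1 (c j) l)) -
        ∑ i ∈ Finset.univ.erase j, lineRestrict l (curvature e l b.1.1 (c a) (c i)) * b.1.2 i := by
      intro b
      have h1 := b.2.2.2 a
      rw [← Finset.add_sum_erase _ _ (Finset.mem_univ j), b.2.1, mul_one] at h1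
      rw [← neg_eq_iff_add_eq_zero.2 h1]
      simp only [curvature, Matrix.of_apply, map_sub, lieDeriv_adaptedFrame e _ (c a), map_add]
      ring
    simp only [heq]
    exact ((hlie _ _ (hc.ne ha)).sub (htail _ _)).sub hsum
  have hcoeff : ∀ (r : Fin m) (i : Fin n) (α : Fin n →₀ ℕ), α.degree ≤ d →
      (fun b : KernelData e l c j k => MvPowerSeries.coeff α (b.1.1 r i)) ∈ A := by
    intro r i α hα
    by_cases ht : (r, i, ⟨α, hα⟩) ∈ U
    · obtain ⟨a, s, ha, hs, hr, hi, hα'⟩ := ht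
      dsimp only at hr hi hα'
      rw [hr, hi, hα']
      have hne : l ≠ e (c a) := fun h => hl ⟨_, h.symm⟩
      -- The differentiated exponent is `0` on the line, so the derivative contributes the factor
      -- `1`.
      have h1 := hsolved a ha s hs
      simpa [coeff_lineRestrict, MvPowerSeries.coeff_pderiv, Finsupp.single_apply, hne] using h1
    · exact hfree r i α hα ht
  rintro ⟨r, i, α, hα⟩
  simp only [jet, assemble, map_sum, MvPowerSeries.coeff_mul]
  refine A.mul_mem (hconst _) ?_
  have hframe : ∀ (s : Fin m) (β : Fin n →₀ ℕ), β.degree ≤ d →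
      (fun b : KernelData e l c j k => MvPowerSeries.coeff β (adaptedFrame e b.1.1 s i)) ∈ A := by
    intro s β hβ
    by_cases hi : i ∈ Set.range e
    · simp only [adaptedFrame, if_pos hi]
      exact hconst _
    · simp only [adaptedFrame_apply_of_notMem e _ s hi]
      exact hcoeff s i β hβ
  have := A.sum_mem (t := Finset.univ) fun s (_ : s ∈ Finset.univ) =>
    A.sum_mem (t := Finset.HasAntidiagonal.antidiagonal α) fun p hp => A.mul_mem
      (hcoeff r (e s) p.1 ((Finsupp.degree_mono (fst_le_of_mem_antidiagonal hp)).trans hα))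
      (hframe s p.2 ((Finsupp.degree_mono (snd_le_of_mem_antidiagonal hp)).trans hα))
  convert! this using 1
  funext b
  simp

/-! ### Generic maximality of the rank -/

/-- Restriction to a line replaces power series in `n` variables by the valuation ring `ℝ⟦t⟧`, where
kernel vectors can be normalized. -/
theorem exists_mem_kernelData (e : Fin m ↪ Fin n) (l : Fin n) (c : Fin M → Fin m)
    (Y : Fin m → FormalVF n) (hM : Even M) (h : ((curvature e l Y).submatrix c c).det = 0) :
    ∃ (j k : Fin M), j ≠ k ∧ ∃ v, (Y, v) ∈ KernelData e l c j k := by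
  have : CharZero (PowerSeries ℝ) := algebraRat.charZero _
  let g := ((curvature e l Y).submatrix c c).map (lineRestrict l)
  have hdet : g.det = 0 := by
    have := (lineRestrict l).map_det ((curvature e l Y).submatrix c c)
    rw [h, map_zero] at this
    exact this.symm
  have hskew : g.transpose = -g := by
    change (((curvature e l Y).submatrix c c).map (lineRestrict l)).transpose = -g
    rw [← Matrix.transpose_map, Matrix.transpose_submatrix, transpose_curvature]
    ext1 a b
    simp [g]
  obtain ⟨j, k, hjk, v, hv, hj, hk⟩ := exists_mulVec_eq_zero_of_skew g hskew (by simpa using hM) hdet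
  exact ⟨j, k, hjk, v, hj, hk, fun a => congrFun hv a⟩

theorem succ_le_card_jetIndex {d : ℕ} (hm : 1 ≤ m) (hmn : m < n) (hd : n ≤ d) :
    n + 1 ≤ Nat.card (JetIndex n m d) := by
  let f : Fin (n + 1) → JetIndex n m d := fun s =>
    (⟨0, hm⟩, ⟨0, by omega⟩, ⟨Finsupp.single ⟨0, by omega⟩ s.1, by
      rw [Finsupp.degree_single]; omega⟩)
  have hf : Function.Injective f := by
    intro s s' h
    have h1 : Finsupp.single (⟨0, by omega⟩ : Fin n) s.1 = Finsupp.single ⟨0, by omega⟩ s'.1 :=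
      congrArg (fun t : JetIndex n m d => t.2.2.1) h
    exact Fin.ext (Finsupp.single_injective _ h1)
  simpa using Nat.card_le_card_of_injective f hf

theorem exists_generic_le_gohRank {d : ℕ} (hm : 1 ≤ m) (hmn : m < n) (hd : n + 1 ≤ d)
    (hM : Even M) (hMm : M ≤ m) :
    ∃ G : Set (JetSpace n m d), IsOpen G ∧ Dense G ∧ IsSemialgebraicOfCodim Gᶜ (n + 1) ∧
      ∀ X : Fin m → FormalVF n, IsLinIndepAtOrigin X → jet d X ∈ G → M ≤ gohRank X := by
  let c : Fin M → Fin m := Fin.castLE hMm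
  -- Finitely many choices of `e`, `l`, `j`, `k`, so that one `G` serves all tuples `X`.
  let I := {p : (Fin m ↪ Fin n) × Fin n × Fin M × Fin M //
    p.2.1 ∉ Set.range p.1 ∧ p.2.2.1 ≠ p.2.2.2}
  let S : I → Set (JetSpace n m d) := fun p =>
    (fun b => jet d (assemble p.1.1 b.1)) '' KernelData p.1.1 p.1.2.1 c p.1.2.2.1 p.1.2.2.2
  have hD : Nat.card (JetIndex n m d) - (n + 1) + (n + 1) = Nat.card (JetIndex n m d) :=
    Nat.sub_add_cancel (succ_le_card_jetIndex hm hmn (by omega))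
  have hS : AlgDimLE (⋃ p, S p) (Nat.card (JetIndex n m d) - (n + 1)) :=
    AlgDimLE.iUnion fun p => algDimLE_jet_kernelData p.1.1 p.2.1 (Fin.castLE_injective hMm) p.2.2
      hd hD
  obtain ⟨G, hGo, hGd, hGc, hGS⟩ := exists_open_dense_disjoint n.succ_pos hD hS
  refine ⟨G, hGo, hGd, hGc, fun X hX hXG => ?_⟩
  obtain ⟨e, Y, rfl, hY⟩ := exists_assemble X hX
  obtain ⟨l, hl⟩ : ∃ l, l ∉ Set.range e := by
    by_contra! h
    have := Fintype.card_le_of_surjective e h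
    simp only [Fintype.card_fin] at this
    omega
  by_cases hdet : ((curvature e l Y).submatrix c c).det = 0
  · obtain ⟨j, k, hjk, v, hv⟩ := exists_mem_kernelData e l c Y hM hdet
    let p : I := ⟨(e, l, j, k), hl, hjk⟩
    have hmem : jet d (assemble e Y) ∈ S p := ⟨(Y, v), hv, rfl⟩
    exact absurd (Set.mem_iUnion.2 ⟨p, hmem⟩) (Set.disjoint_left.1 hGS hXG)
  · exact le_gohRank_assemble e hl Y hY c hdet

theorem isPrime_annIdeal (X : Fin m → FormalVF n) (hX : IsLinIndepAtOrigin X) :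
    (annIdeal X).IsPrime := by
  obtain ⟨e, Y, rfl, hY⟩ := exists_assemble X hX
  exact isPrime_annIdeal_assemble e Y hY

end FormalGoh
end

theorem proposition4p3 (n m d : ℕ) (hm : 1 ≤ m) (hmn : m < n) (hd : n + 2 ≤ d) :
    ∃ G : Set (FormalGoh.JetSpace n m d),
      IsOpen G ∧ Dense G ∧ FormalGoh.IsSemialgebraicOfCodim Gᶜ (n + 1) ∧
      ∀ X : Fin m → FormalGoh.FormalVF n,
        FormalGoh.IsLinIndepAtOrigin X → FormalGoh.jet d X ∈ G →
          (FormalGoh.annIdeal X).IsPrime ∧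
          (Even m → FormalGoh.gohRank X = m) ∧
          (Odd m → FormalGoh.gohRank X = m - 1) := by
  -- The largest even size at most `m`. For `m = 1` it is `0`, and the lower bound is vacuous.
  obtain ⟨G, hGo, hGd, hGc, hG⟩ := FormalGoh.exists_generic_le_gohRank (M := 2 * (m / 2)) hm hmn
    (by omega : n + 1 ≤ d) (even_two_mul _) (by omega)
  refine ⟨G, hGo, hGd, hGc, fun X hX hXG => ?_⟩
  have hprime := FormalGoh.isPrime_annIdeal X hX
  have hlow := hG X hX hXG
  refine ⟨hprime, fun heven => ?_, fun hodd => ?_⟩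
  · have := FormalGoh.gohRank_le X hprime
    obtain ⟨r, hr⟩ := heven
    omega
  · have := FormalGoh.gohRank_lt_of_odd X hprime hodd
    obtain ⟨r, hr⟩ := hodd
    omega
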